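/- Let $\mathbb{N}_0=\{0,1,2,\dots\}$ and let $(\mathbb{N}_0,b,m)$ be a birth-death chain: $m\colon\mathbb{N}_0\to(0,\infty)$ is a strictly positive vertex measure and $b\colon\mathbb{N}_0\times\mathbb{N}_0\to[0,\infty)$ is a symmetric edge weight with $b(x,y)>0$ if and only if $|x-y|=1$. Let $\ell^2(\mathbb{N}_0,m)$ be the real Hilbert space of all $f\colon\mathbb{N}_0\to\mathbb{R}$ with $\sum_{x} f(x)^2m(x)<\infty$, with inner product $\langle f,g\rangle=\sum_x f(x)g(x)m(x)$, and let $L_c$ be the operator on $\ell^2(\mathbb{N}_0,m)$ whose domain is the space of finitely supported functions and which acts by $$L_c f(x)=\frac{1}{m(x)}\sum_{y\in\mathbb{N}_0} b(x,y)\,(f(x)-f(y)).$$ Then the following statements are equivalent: (i) $L_c$ is essentially self-adjoint, that is, $L_c$ has a unique self-adjoint extension. (ii) $\displaystyle\sum_{r=0}^\infty\left(\sum_{k=0}^r\frac{1}{b(k,k+1)}\right)^2 m(r+1)=\infty.$ -/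

import Mathlib

/-- A weighted graph `(X, b, m)`: a symmetric edge weight `b` with values in `[0, ∞)` that vanishes
on the diagonal and is summable at every vertex, and a strictly positive vertex measure `m`. -/
structure WeightedGraph (X : Type*) where
  /-- the edge weight -/
  b : X → X → ℝ
  /-- the vertex measure -/
  m : X → ℝ
  b_nonneg : ∀ x y, 0 ≤ b x y
  b_symm : ∀ x y, b x y = b y x
  b_diag : ∀ x, b x x = 0
  b_summable : ∀ x, Summable fun y => b x y
  m_pos : ∀ x, 0 < m x

namespace WeightedGraph

variable {X : Type*} (G : WeightedGraph X)

/-- The linear space of all functions `f : X → ℝ` with `∑ f(x)² m(x) < ∞`. -/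
def squareSummable : Submodule ℝ (X → ℝ) where
  carrier := {f | Summable fun x => f x ^ 2 * G.m x}
  zero_mem' := by simp [summable_zero]
  add_mem' := by
    intro f g hf hg
    refine Summable.of_nonneg_of_le (fun x => mul_nonneg (sq_nonneg _) (G.m_pos x).le)
      (fun x => ?_) ((hf.add hg).mul_left 2)
    have h := mul_nonneg (sq_nonneg (f x - g x)) (G.m_pos x).le
    simp only [Pi.add_apply]
    nlinarith
  smul_mem' := by
    intro c f hf
    refine (Summable.mul_left (c ^ 2) hf).congr fun x => ?_
    simp only [Pi.smul_apply, smul_eq_mul]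
    ring

/-- The space `ℓ²(X, m)` as a type of its own, which carries the norm and topology that come from
the weighted inner product below (and not the topology of pointwise convergence). -/
def Ell2 : Type _ := G.squareSummable

namespace Ell2

noncomputable instance : AddCommGroup G.Ell2 := inferInstanceAs (AddCommGroup G.squareSummable)

noncomputable instance : Module ℝ G.Ell2 := inferInstanceAs (Module ℝ G.squareSummable)

variable {G}

/-- An element of `ℓ²(X, m)` is a function on `X`. -/
instance : FunLike G.Ell2 X ℝ := ⟨Subtype.val, Subtype.val_injective⟩

/-- The element of `ℓ²(X, m)` given by a square summable function. -/
def mk (f : X → ℝ) (hf : f ∈ G.squareSummable) : G.Ell2 := ⟨f, hf⟩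

@[simp] theorem mk_apply (f : X → ℝ) (hf : f ∈ G.squareSummable) (x : X) :
    (mk f hf : G.Ell2) x = f x := rfl

@[simp] theorem add_apply (f g : G.Ell2) (x : X) : (f + g) x = f x + g x := rfl

@[simp] theorem smul_apply (c : ℝ) (f : G.Ell2) (x : X) : (c • f) x = c * f x := rfl

@[simp] theorem zero_apply (x : X) : (0 : G.Ell2) x = 0 := rfl

@[ext] protected theorem ext {f g : G.Ell2} (h : ∀ x, f x = g x) : f = g := DFunLike.ext f g h

theorem summable_sq (f : G.Ell2) : Summable fun x => f x ^ 2 * G.m x := Subtype.property f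

theorem summable_mul (f g : G.Ell2) : Summable fun x => f x * g x * G.m x := by
  refine (((f + g).summable_sq.sub f.summable_sq).sub g.summable_sq).mul_left (1 / 2) |>.congr
    fun x => ?_
  simp only [add_apply]
  ring

/-- The inner product `⟨f, g⟩ = ∑ f(x) g(x) m(x)` on `ℓ²(X, m)`. -/
@[reducible] noncomputable def core : InnerProductSpace.Core ℝ G.Ell2 where
  inner f g := ∑' x, f x * g x * G.m x
  conj_inner_symm f g := by
    simp only [conj_trivial]
    exact tsum_congr fun x => by ring
  re_inner_nonneg f := by
    simp only [RCLike.re_to_real]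
    exact tsum_nonneg fun x => mul_nonneg (mul_self_nonneg _) (G.m_pos x).le
  add_left f g h := by
    rw [← (summable_mul f h).tsum_add (summable_mul g h)]
    exact tsum_congr fun x => by simp only [add_apply]; ring
  smul_left f g c := by
    simp only [conj_trivial]
    rw [← tsum_mul_left]
    exact tsum_congr fun x => by simp only [smul_apply]; ring
  definite f hf := by
    have h0 : ∀ x, 0 ≤ f x * f x * G.m x := fun x =>
      mul_nonneg (mul_self_nonneg _) (G.m_pos x).le
    have h := ((summable_mul f f).hasSum_iff.2 hf)
    rw [hasSum_zero_iff_of_nonneg h0] at h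
    ext x
    have hx := congrFun h x
    simp only [Pi.zero_apply, mul_eq_zero, or_self, (G.m_pos x).ne', or_false] at hx
    exact hx

noncomputable instance : NormedAddCommGroup G.Ell2 :=
  InnerProductSpace.Core.toNormedAddCommGroup (cd := core)

noncomputable instance : InnerProductSpace ℝ G.Ell2 := InnerProductSpace.ofCore core.toCore

theorem inner_def (f g : G.Ell2) : inner ℝ f g = ∑' x, f x * g x * G.m x := rfl

/-- Multiplication by `√m` as an isometry of `ℓ²(X, m)` onto the unweighted `ℓ²(X)`. -/
noncomputable def toLp : G.Ell2 ≃ₗᵢ[ℝ] lp (fun _ : X => ℝ) 2 :=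
  LinearEquiv.isometryOfInner
    { toFun := fun f => ⟨fun x => f x * √(G.m x), by
        refine (memℓp_gen_iff (by norm_num)).2 (f.summable_sq.congr fun x => ?_)
        simp [mul_pow, Real.sq_sqrt (G.m_pos x).le]⟩
      map_add' := fun f g => by
        ext x
        exact add_mul (f x) (g x) _
      map_smul' := fun c f => by
        ext x
        exact mul_assoc c (f x) _
      invFun := fun f => mk (fun x => f x / √(G.m x)) (by
        refine ((memℓp_gen_iff (by norm_num)).1 (lp.memℓp f)).congr fun x => ?_
        have := (G.m_pos x).ne'
        simp [div_pow, Real.sq_sqrt (G.m_pos x).le]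
        field_simp)
      left_inv := fun f => by
        ext x
        exact mul_div_cancel_right₀ (f x) (Real.sqrt_pos.2 (G.m_pos x)).ne'
      right_inv := fun f => by
        ext x
        exact div_mul_cancel₀ (f x) (Real.sqrt_pos.2 (G.m_pos x)).ne' }
    (fun f g => by
      rw [lp.inner_eq_tsum, inner_def]
      refine tsum_congr fun x => ?_
      have := Real.mul_self_sqrt (G.m_pos x).le
      simp
      linear_combination f x * g x * this)

instance : CompleteSpace G.Ell2 :=
  (completeSpace_congr (e := (toLp (G := G)).toEquiv) (toLp (G := G)).isometry.isUniformEmbedding).2 inferInstance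

end Ell2

/-- The formal Laplacian `Δ f(x) = m(x)⁻¹ ∑ b(x, y) (f(x) - f(y))`. -/
noncomputable def laplacian (f : X → ℝ) (x : X) : ℝ :=
  1 / G.m x * ∑' y, G.b x y * (f x - f y)

/-- The condition `∑ b(x, y)² / m(y) < ∞` for every vertex `x`, which makes the formal Laplacian map
finitely supported functions to square summable ones. -/
def AssumptionA : Prop := ∀ x, Summable fun y => G.b x y ^ 2 / G.m y

variable {G}

theorem summable_mul_of_finite {f : X → ℝ} (hf : f.support.Finite) (x : X) :
    Summable fun y => G.b x y * f y :=
  summable_of_hasFiniteSupport (hf.subset fun _ hy => right_ne_zero_of_mul hy)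

theorem summable_mul_sub_of_finite {f : X → ℝ} (hf : f.support.Finite) (x : X) :
    Summable fun y => G.b x y * (f x - f y) :=
  (((G.b_summable x).mul_right (f x)).sub (summable_mul_of_finite hf x)).congr fun y => by ring

theorem mem_squareSummable_of_finite {f : X → ℝ} (hf : f.support.Finite) :
    f ∈ G.squareSummable :=
  summable_of_hasFiniteSupport (hf.subset fun x hx h => hx (by simp [h]))

theorem laplacian_mem_squareSummable (hA : G.AssumptionA) {f : X → ℝ} (hf : f.support.Finite) :
    G.laplacian f ∈ G.squareSummable := by
  have key : G.laplacian f = (fun x => f x * (1 / G.m x * ∑' y, G.b x y)) -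
      ∑ y ∈ hf.toFinset, f y • fun x => G.b x y / G.m x := by
    ext x
    have h1 : ∑' y, G.b x y * f y = ∑ y ∈ hf.toFinset, G.b x y * f y :=
      tsum_eq_sum fun y hy => by
        simp only [Set.Finite.mem_toFinset, Function.mem_support, not_not] at hy
        simp [hy]
    have h2 : ∑' y, G.b x y * (f x - f y) = (∑' y, G.b x y) * f x - ∑' y, G.b x y * f y := by
      rw [← tsum_mul_right,
        ← ((G.b_summable x).mul_right (f x)).tsum_sub (summable_mul_of_finite hf x)]
      exact tsum_congr fun y => by ring
    simp only [laplacian, h2, h1, Pi.sub_apply, Finset.sum_apply, Pi.smul_apply, smul_eq_mul]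
    rw [mul_sub, Finset.mul_sum]
    congr 1
    · ring
    · exact Finset.sum_congr rfl fun y _ => by ring
  rw [key]
  refine Submodule.sub_mem _ (mem_squareSummable_of_finite
    (hf.subset fun x hx => left_ne_zero_of_mul hx)) (Submodule.sum_mem _ fun y _ =>
      Submodule.smul_mem _ _ ((hA y).congr fun x => ?_))
  have := (G.m_pos x).ne'
  rw [G.b_symm y x]
  field_simp

/-- The operator `L_c` on `ℓ²(X, m)`: the restriction of the formal Laplacian to the space `C_c(X)`
of finitely supported functions. -/
noncomputable def minimalLaplacian (hA : G.AssumptionA) : G.Ell2 →ₗ.[ℝ] G.Ell2 where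
  domain :=
    { carrier := {f | (Function.support f).Finite}
      zero_mem' := by
        refine Set.Finite.subset Set.finite_empty fun x hx => hx rfl
      add_mem' := fun {f g} hf hg => (Set.Finite.union hf hg).subset (Function.support_add _ _)
      smul_mem' := fun c f hf => Set.Finite.subset hf fun x hx => right_ne_zero_of_mul hx }
  toFun :=
    { toFun := fun f => Ell2.mk (G.laplacian (f : G.Ell2)) (laplacian_mem_squareSummable hA f.2)
      map_add' := fun f g => by
        ext x
        simp only [Ell2.mk_apply, Ell2.add_apply, laplacian]
        rw [← mul_add, ← (summable_mul_sub_of_finite f.2 x).tsum_add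
          (summable_mul_sub_of_finite g.2 x)]
        congr 1
        exact tsum_congr fun y => by
          simp only [Submodule.coe_add, Ell2.add_apply]
          ring
      map_smul' := fun c f => by
        ext x
        simp only [Ell2.mk_apply, Ell2.smul_apply, laplacian, RingHom.id_apply]
        rw [mul_left_comm, ← tsum_mul_left (a := c)]
        congr 1
        exact tsum_congr fun y => by
          simp only [Submodule.coe_smul, Ell2.smul_apply]
          ring }

/-- A weighted graph over `ℕ₀ = {0, 1, 2, …}` is a birth-death chain if exactly the subsequent
numbers are neighbors. Such a graph is automatically connected. -/
def IsBirthDeathChain (G : WeightedGraph ℕ) : Prop :=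
  ∀ x y : ℕ, 0 < G.b x y ↔ |(x : ℤ) - (y : ℤ)| = 1

theorem IsBirthDeathChain.assumptionA {G : WeightedGraph ℕ} (hG : G.IsBirthDeathChain) :
    G.AssumptionA := fun x => by
  refine summable_of_hasFiniteSupport ((Set.finite_Iic (x + 1)).subset fun y hy => ?_)
  have hb : 0 < G.b x y := (G.b_nonneg x y).lt_of_ne' fun h => hy (by simp [h])
  have h := (abs_eq one_pos.le).1 ((hG x y).1 hb)
  simp only [Set.mem_Iic]
  omega

end WeightedGraph

/-- A partially defined operator on a real Hilbert space is essentially self-adjoint if it has a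
unique self-adjoint extension. -/
def LinearPMap.IsEssentiallySelfAdjoint {H : Type*} [NormedAddCommGroup H] [InnerProductSpace ℝ H]
    [CompleteSpace H] (T : H →ₗ.[ℝ] H) : Prop :=
  ∃! A : H →ₗ.[ℝ] H, IsSelfAdjoint A ∧ T ≤ A

/-! Write R(n) for `resistance`; condition (ii) says that R is not square summable. The operator
`L_c` is symmetric and nonnegative, and its adjoint acts as the formal Laplacian Δ, so `L_c` is
essentially self-adjoint once its adjoint lacks the eigenvalue -1 (`adjoint_symmetric_of_nonneg`). A
nonzero solution of Δf = -f has f(0) ≠ 0 and |f| ≥ |f(0)| m(0) R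
(`resistance_le_of_laplacian_eq_neg`), so it is not in ℓ² if R is not. If R is in ℓ², then so is the
constant 1, and both lie in the domain of the adjoint. The boundary form of the adjoint is the limit
of the Wronskians, equal to 1 on the pair (1, R). By the Plücker identity, vanishing boundary form
against 1, or against R, gives a self-adjoint extension, and the two extensions differ. -/

namespace LinearPMap

open Filter Topology
open scoped InnerProductSpace

variable {H : Type*} [NormedAddCommGroup H] [InnerProductSpace ℝ H]
  {S T : H →ₗ.[ℝ] H}

/-! ### Symmetric operators and self-adjoint restrictions of the adjoint -/

/-- The norm bound `‖x‖ ≤ ‖(T + 1) x‖` for a nonnegative operator. -/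
theorem norm_le_norm_apply_add (hpos : ∀ x : T.domain, 0 ≤ ⟪T x, (x : H)⟫_ℝ) (x : T.domain) :
    ‖(x : H)‖ ≤ ‖T x + x‖ := by
  rcases eq_or_ne ‖(x : H)‖ 0 with h | h
  · rw [h]; positivity
  · have h1 : ‖(x : H)‖ * ‖(x : H)‖ ≤ ‖T x + x‖ * ‖(x : H)‖ := by
      refine le_trans ?_ (real_inner_le_norm _ _)
      rw [inner_add_left, real_inner_self_eq_norm_mul_norm]
      linarith [hpos x]
    exact le_of_mul_le_mul_right h1 (lt_of_le_of_ne (norm_nonneg _) h.symm)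

variable [CompleteSpace H]

/-- Taking adjoints of densely defined operators reverses inclusions. -/
theorem adjoint_le_adjoint_of_le (hS : Dense (S.domain : Set H)) (h : S ≤ T) :
    T.adjoint ≤ S.adjoint := by
  refine IsFormalAdjoint.le_adjoint hS fun x y => ?_
  have hT : Dense (T.domain : Set H) := hS.mono h.1
  rw [h.2 (y := ⟨x, h.1 x.2⟩) rfl]
  exact (adjoint_isFormalAdjoint hT).symm ⟨x, h.1 x.2⟩ y

/-- A densely defined symmetric operator with symmetric adjoint is essentially self-adjoint. -/
theorem isEssentiallySelfAdjoint_of_adjoint_symmetric (hT : Dense (T.domain : Set H))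
    (hsym : T.IsFormalAdjoint T) (hadj : T.adjoint.IsFormalAdjoint T.adjoint) :
    T.IsEssentiallySelfAdjoint := by
  have hle : T ≤ T.adjoint := hsym.le_adjoint hT
  have hsa : T.adjoint.adjoint = T.adjoint :=
    le_antisymm (adjoint_le_adjoint_of_le hT hle) (hadj.le_adjoint (hT.mono hle.1))
  refine ⟨T.adjoint, ⟨hsa, hle⟩, fun A ⟨hA, hTA⟩ => ?_⟩
  have hA' : A.adjoint = A := hA
  have h1 : A ≤ T.adjoint := hA' ▸ adjoint_le_adjoint_of_le hT hTA
  have h2 := adjoint_le_adjoint_of_le (hT.mono hTA.1) h1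
  rw [hsa, hA'] at h2
  exact le_antisymm h1 h2

/-- A nonnegative symmetric operator whose adjoint does not have the eigenvalue `-1` has a
symmetric adjoint. -/
theorem adjoint_symmetric_of_nonneg (hT : Dense (T.domain : Set H))
    (hpos : ∀ x : T.domain, 0 ≤ ⟪T x, (x : H)⟫_ℝ) (hsym : T.IsFormalAdjoint T)
    (hker : ∀ f : T.adjoint.domain, T.adjoint f = -(f : H) → (f : H) = 0) :
    T.adjoint.IsFormalAdjoint T.adjoint := by
  -- The orthogonal complement of the range of T + 1 is the kernel of T† + 1, which `hker` makes
  -- trivial.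
  let R : Submodule ℝ H := LinearMap.range (T.toFun + T.domain.subtype)
  have hR : R.topologicalClosure = ⊤ := by
    rw [Submodule.topologicalClosure_eq_top_iff, Submodule.eq_bot_iff]
    intro g hg
    have h : ∀ x : T.domain, ⟪-g, (x : H)⟫_ℝ = ⟪g, T x⟫_ℝ := fun x => by
      have := (Submodule.mem_orthogonal' R g).1 hg (T x + x) ⟨x, rfl⟩
      rw [inner_add_right] at this
      rw [inner_neg_left]
      linarith
    exact hker ⟨g, mem_adjoint_domain_of_exists g ⟨-g, h⟩⟩ (adjoint_apply_eq hT _ h)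
  -- The graph of T is dense in that of T†: approximate (T† + 1) f by (T + 1) xₙ. The norm bound
  -- makes xₙ Cauchy, and its limit g satisfies (T† + 1) g = (T† + 1) f, so g = f by `hker`.
  have approx : ∀ f : T.adjoint.domain, ∃ x : ℕ → T.domain,
      Tendsto (fun n => (x n : H)) atTop (𝓝 (f : H)) ∧
      Tendsto (fun n => T (x n)) atTop (𝓝 (T.adjoint f)) := by
    intro f
    have hf : T.adjoint f + f ∈ _root_.closure (R : Set H) := by
      rw [← Submodule.topologicalClosure_coe, hR]; trivial
    obtain ⟨y, hyR, hy⟩ := mem_closure_iff_seq_limit.1 hf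
    choose x hx using hyR
    have hx' : ∀ n, T (x n) + x n = y n := hx
    have hc : CauchySeq fun n => (x n : H) := by
      rw [Metric.cauchySeq_iff]
      intro ε hε
      obtain ⟨N, hN⟩ := Metric.cauchySeq_iff.1 hy.cauchySeq ε hε
      refine ⟨N, fun m hm n hn => lt_of_le_of_lt ?_ (hN m hm n hn)⟩
      have := norm_le_norm_apply_add hpos (x m - x n)
      rw [dist_eq_norm, dist_eq_norm, ← hx', ← hx']
      refine this.trans_eq ?_
      rw [LinearPMap.map_sub, Submodule.coe_sub]
      congr 1
      abel
    obtain ⟨g, hg⟩ := cauchySeq_tendsto_of_complete hc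
    have hTx : Tendsto (fun n => T (x n)) atTop (𝓝 (T.adjoint f + f - g)) :=
      (hy.sub hg).congr fun n => by rw [← hx']; abel
    have h : ∀ z : T.domain, ⟪T.adjoint f + f - g, (z : H)⟫_ℝ = ⟪g, T z⟫_ℝ := fun z =>
      tendsto_nhds_unique (hTx.inner tendsto_const_nhds)
        ((hg.inner tendsto_const_nhds).congr fun n => (hsym (x n) z).symm)
    let g' : T.adjoint.domain := ⟨g, mem_adjoint_domain_of_exists g ⟨_, h⟩⟩
    have hg' : T.adjoint g' = T.adjoint f + f - g := adjoint_apply_eq hT _ h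
    have hfg : (f : H) - g = 0 := hker (f - g') (by
      rw [LinearPMap.map_sub, hg', Submodule.coe_sub]; abel)
    rw [← sub_eq_zero.1 hfg] at hg hTx
    exact ⟨x, hg, by simpa using hTx⟩
  intro f g
  obtain ⟨x, hx, hTx⟩ := approx f
  refine tendsto_nhds_unique (hTx.inner tendsto_const_nhds)
    ((hx.inner tendsto_const_nhds).congr fun n => ?_)
  exact (adjoint_isFormalAdjoint hT).symm (x n) g |>.symm

variable (T) in
/-- The restriction of the adjoint of `T` by the boundary condition `⟪T† f, v⟫ = ⟪f, T† v⟫`. -/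
noncomputable def adjointBoundaryRestrict (v : T.adjoint.domain) : H →ₗ.[ℝ] H :=
  T.adjoint.domRestrict (Submodule.map T.adjoint.domain.subtype
    (LinearMap.ker (innerₗ H (v : H) ∘ₗ T.adjoint.toFun -
      innerₗ H (T.adjoint v) ∘ₗ T.adjoint.domain.subtype)))

theorem mem_adjointBoundaryRestrict_domain {v : T.adjoint.domain} (f : T.adjoint.domain) :
    (f : H) ∈ (T.adjointBoundaryRestrict v).domain ↔
      ⟪T.adjoint f, (v : H)⟫_ℝ = ⟪(f : H), T.adjoint v⟫_ℝ := by
  rw [adjointBoundaryRestrict, domRestrict_domain, Submodule.mem_inf, and_iff_left f.2,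
    Submodule.mem_map]
  constructor
  · rintro ⟨g, hg, hgf⟩
    obtain rfl : g = f := Subtype.ext hgf
    have := sub_eq_zero.1 (LinearMap.mem_ker.1 hg)
    rw [real_inner_comm, real_inner_comm (T.adjoint v)]
    exact this
  · intro h
    refine ⟨f, LinearMap.mem_ker.2 (sub_eq_zero.2 ?_), rfl⟩
    rw [real_inner_comm, real_inner_comm (T.adjoint v)] at h
    exact h

theorem adjointBoundaryRestrict_le (v : T.adjoint.domain) :
    T.adjointBoundaryRestrict v ≤ T.adjoint := domRestrict_le

theorem le_adjointBoundaryRestrict (hT : Dense (T.domain : Set H)) (hsym : T.IsFormalAdjoint T)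
    (v : T.adjoint.domain) : T ≤ T.adjointBoundaryRestrict v := by
  have hle : T ≤ T.adjoint := hsym.le_adjoint hT
  refine ⟨fun x hx => ?_, fun x y hxy => ?_⟩
  · refine (mem_adjointBoundaryRestrict_domain ⟨x, hle.1 hx⟩).2 ?_
    rw [← hle.2 (x := ⟨x, hx⟩) rfl]
    exact (adjoint_isFormalAdjoint hT).symm ⟨x, hx⟩ v
  · rw [(adjointBoundaryRestrict_le v).2 (x := y) (y := ⟨x, hle.1 x.2⟩) hxy.symm]
    exact hle.2 rfl

/-- If the boundary condition given by `v` makes the adjoint of `T` symmetric, then it makes it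
self-adjoint. -/
theorem isSelfAdjoint_adjointBoundaryRestrict (hT : Dense (T.domain : Set H))
    (hsym : T.IsFormalAdjoint T) (v : T.adjoint.domain)
    (h : ∀ f g : T.adjoint.domain, ⟪T.adjoint f, (v : H)⟫_ℝ = ⟪(f : H), T.adjoint v⟫_ℝ →
      ⟪T.adjoint g, (v : H)⟫_ℝ = ⟪(g : H), T.adjoint v⟫_ℝ →
      ⟪T.adjoint f, (g : H)⟫_ℝ = ⟪(f : H), T.adjoint g⟫_ℝ) :
    IsSelfAdjoint (T.adjointBoundaryRestrict v) := by
  set A := T.adjointBoundaryRestrict v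
  have hAT : A ≤ T.adjoint := adjointBoundaryRestrict_le v
  have hTA : T ≤ A := le_adjointBoundaryRestrict hT hsym v
  have hAd : Dense (A.domain : Set H) := hT.mono hTA.1
  have hAA : A.IsFormalAdjoint A := fun f g => by
    rw [hAT.2 (x := f) (y := ⟨f, hAT.1 f.2⟩) rfl, hAT.2 (x := g) (y := ⟨g, hAT.1 g.2⟩) rfl]
    exact h _ _ ((mem_adjointBoundaryRestrict_domain (T := T) ⟨f, hAT.1 f.2⟩).1 f.2)
      ((mem_adjointBoundaryRestrict_domain (T := T) ⟨g, hAT.1 g.2⟩).1 g.2)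
  have hle : A.adjoint ≤ T.adjoint := adjoint_le_adjoint_of_le hT hTA
  have hv : (v : H) ∈ A.domain :=
    (mem_adjointBoundaryRestrict_domain v).2 (real_inner_comm _ _)
  have hAA' : A ≤ A.adjoint := hAA.le_adjoint hAd
  suffices hA'A : A.adjoint ≤ A from le_antisymm hA'A hAA'
  -- Since `v` lies in the domain of `A`, pairing A† f with `v` is exactly the boundary condition
  -- for f.
  refine ⟨fun f hf => ?_, fun f g hfg => ?_⟩
  · refine (mem_adjointBoundaryRestrict_domain ⟨f, hle.1 hf⟩).2 ?_
    rw [← hle.2 (x := ⟨f, hf⟩) rfl, ← hAT.2 (x := ⟨v, hv⟩) (y := v) rfl]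
    exact adjoint_isFormalAdjoint hAd ⟨f, hf⟩ ⟨v, hv⟩
  · exact (hAA'.2 hfg.symm).symm

end LinearPMap

namespace WeightedGraph

open Filter Topology LinearPMap
open scoped InnerProductSpace

/-! ### Flux, Wronskian, resistance and unit masses -/

/-- The flux of `f` through the edge between `n` and `n + 1`. -/
def flux (G : WeightedGraph ℕ) (f : ℕ → ℝ) (n : ℕ) : ℝ := G.b n (n + 1) * (f n - f (n + 1))

/-- The discrete Wronskian of `f` and `g` at the edge between `n` and `n + 1`. -/
def wronskian (G : WeightedGraph ℕ) (f g : ℕ → ℝ) (n : ℕ) : ℝ :=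
  G.b n (n + 1) * (f n * g (n + 1) - f (n + 1) * g n)

/-- The resistance between `0` and `n` along the path `0, 1, …, n`. -/
noncomputable def resistance (G : WeightedGraph ℕ) (n : ℕ) : ℝ :=
  ∑ k ∈ Finset.range n, 1 / G.b k (k + 1)

theorem resistance_mem_squareSummable_iff (G : WeightedGraph ℕ) :
    G.resistance ∈ G.squareSummable ↔
      ∑' r : ℕ, ENNReal.ofReal (G.resistance (r + 1) ^ 2 * G.m (r + 1)) ≠ ⊤ := by
  have h0 : ∀ r, 0 ≤ G.resistance (r + 1) ^ 2 * G.m (r + 1) := fun r =>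
    mul_nonneg (sq_nonneg _) (G.m_pos _).le
  change Summable (fun n => G.resistance n ^ 2 * G.m n) ↔ _
  rw [← summable_nat_add_iff 1]
  refine ⟨fun h => h.tsum_ofReal_ne_top, fun h => (ENNReal.summable_toReal h).congr fun r => ?_⟩
  exact ENNReal.toReal_ofReal (h0 r)

/-- The Plücker relation for 2 × 2 minors. With W(p, q) = 1 it expresses W(f, g) through Wronskians
against p and q alone. -/
theorem wronskian_plucker (G : WeightedGraph ℕ) (f g p q : ℕ → ℝ) (n : ℕ) :
    G.wronskian f g n * G.wronskian p q n =
      G.wronskian f p n * G.wronskian g q n - G.wronskian f q n * G.wronskian g p n := by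
  simp only [wronskian]
  ring

theorem eventually_eq_zero_of_finite {f : ℕ → ℝ} (hf : f.support.Finite) :
    ∀ᶠ n in atTop, f n = 0 := by
  rw [← Nat.cofinite_eq_atTop]
  exact hf.subset fun _ hx => hx

theorem eventually_wronskian_eq_zero (G : WeightedGraph ℕ) (f : ℕ → ℝ) {g : ℕ → ℝ}
    (hg : g.support.Finite) : ∀ᶠ n in atTop, G.wronskian f g n = 0 := by
  have h := eventually_eq_zero_of_finite hg
  filter_upwards [h, (tendsto_add_atTop_nat 1).eventually h] with n h0 h1
  simp [wronskian, h0, h1]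

/-- The unit mass at a vertex, as an element of the domain of the minimal Laplacian. -/
noncomputable def unitMass {X : Type*} {G : WeightedGraph X} (hA : G.AssumptionA) (x : X) :
    (G.minimalLaplacian hA).domain :=
  have h : (Function.support fun y => Set.indicator {x} (1 : X → ℝ) y).Finite :=
    (Set.finite_singleton x).subset Set.support_indicator_subset
  ⟨Ell2.mk _ (mem_squareSummable_of_finite h), h⟩

theorem unitMass_apply_self {X : Type*} {G : WeightedGraph X} (hA : G.AssumptionA) (x : X) :
    (unitMass hA x : G.Ell2) x = 1 :=
  Set.indicator_of_mem rfl _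

theorem unitMass_apply_of_ne {X : Type*} {G : WeightedGraph X} (hA : G.AssumptionA) {x y : X}
    (h : y ≠ x) : (unitMass hA x : G.Ell2) y = 0 :=
  Set.indicator_of_notMem (s := {x}) h _

theorem inner_unitMass {X : Type*} {G : WeightedGraph X} (hA : G.AssumptionA) (f : G.Ell2)
    (x : X) : ⟪f, (unitMass hA x : G.Ell2)⟫_ℝ = f x * G.m x := by
  rw [Ell2.inner_def, tsum_eq_single x fun y hy => by rw [unitMass_apply_of_ne hA hy]; ring,
    unitMass_apply_self]
  ring

theorem dense_minimalLaplacian_domain {X : Type*} {G : WeightedGraph X} (hA : G.AssumptionA) :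
    Dense ((G.minimalLaplacian hA).domain : Set G.Ell2) := by
  rw [Submodule.dense_iff_topologicalClosure_eq_top, Submodule.topologicalClosure_eq_top_iff,
    Submodule.eq_bot_iff]
  intro f hf
  ext x
  have h := (Submodule.mem_orthogonal' _ f).1 hf _ (unitMass hA x).2
  rw [inner_unitMass] at h
  exact (mul_eq_zero.1 h).resolve_right (G.m_pos x).ne'

/-! ### Green's formula and the adjoint on a birth-death chain -/

namespace IsBirthDeathChain

variable {G : WeightedGraph ℕ} (hG : G.IsBirthDeathChain)

include hG

theorem b_pos (n : ℕ) : 0 < G.b n (n + 1) := (hG _ _).2 (by simp)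

theorem b_eq_zero {x y : ℕ} (h₁ : y ≠ x + 1) (h₂ : x ≠ y + 1) : G.b x y = 0 := by
  refine le_antisymm (not_lt.1 fun h => ?_) (G.b_nonneg x y)
  have := (abs_eq one_pos.le).1 ((hG x y).1 h)
  omega

theorem laplacian_zero (f : ℕ → ℝ) : G.laplacian f 0 * G.m 0 = G.flux f 0 := by
  have := (G.m_pos 0).ne'
  rw [laplacian, tsum_eq_single 1 fun y hy => by rw [hG.b_eq_zero hy (by omega), zero_mul], flux]
  field_simp

theorem laplacian_succ (f : ℕ → ℝ) (n : ℕ) :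
    G.laplacian f (n + 1) * G.m (n + 1) = G.flux f (n + 1) - G.flux f n := by
  have := (G.m_pos (n + 1)).ne'
  have h : ∑' y, G.b (n + 1) y * (f (n + 1) - f y) =
      ∑ y ∈ {n, n + 2}, G.b (n + 1) y * (f (n + 1) - f y) := by
    refine tsum_eq_sum fun y hy => ?_
    simp only [Finset.mem_insert, Finset.mem_singleton, not_or] at hy
    rw [hG.b_eq_zero (by omega) (by omega), zero_mul]
  rw [laplacian, h, Finset.sum_pair (by omega), flux, flux, G.b_symm (n + 1) n]
  field_simp
  ring

/-- Green's formula on `{0, …, n}`. -/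
theorem sum_laplacian_mul_sub (f g : ℕ → ℝ) (n : ℕ) :
    ∑ x ∈ Finset.range (n + 1), G.laplacian f x * g x * G.m x -
      ∑ x ∈ Finset.range (n + 1), f x * G.laplacian g x * G.m x = G.wronskian f g n := by
  induction n with
  | zero =>
    have hf := hG.laplacian_zero f
    have hg := hG.laplacian_zero g
    simp only [flux, wronskian, zero_add, Finset.sum_range_one] at *
    linear_combination g 0 * hf - f 0 * hg
  | succ n ih =>
    have hf := hG.laplacian_succ f n
    have hg := hG.laplacian_succ g n
    rw [Finset.sum_range_succ, Finset.sum_range_succ _ (n + 1)]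
    simp only [flux, wronskian] at *
    linear_combination ih + g (n + 1) * hf - f (n + 1) * hg

/-- Both sums in Green's formula converge by square summability, so the boundary term at infinity
exists. -/
theorem tendsto_wronskian {f F g K : G.Ell2} (hF : ∀ x, F x = G.laplacian f x)
    (hK : ∀ x, K x = G.laplacian g x) :
    Tendsto (G.wronskian f g) atTop (𝓝 (⟪F, g⟫_ℝ - ⟪f, K⟫_ℝ)) := by
  refine (((F.summable_mul g).hasSum.tendsto_sum_nat.sub
    (f.summable_mul K).hasSum.tendsto_sum_nat).comp (tendsto_add_atTop_nat 1)).congr fun n => ?_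
  simp only [Function.comp_apply, hF, hK]
  exact hG.sum_laplacian_mul_sub f g n

theorem inner_eq_of_finite {f F : G.Ell2} (hF : ∀ x, F x = G.laplacian f x)
    (φ : (G.minimalLaplacian hG.assumptionA).domain) :
    ⟪F, (φ : G.Ell2)⟫_ℝ = ⟪f, G.minimalLaplacian hG.assumptionA φ⟫_ℝ := by
  refine sub_eq_zero.1 (tendsto_nhds_unique (hG.tendsto_wronskian hF fun _ => rfl)
    (tendsto_const_nhds.congr' ?_))
  filter_upwards [G.eventually_wronskian_eq_zero f φ.2] with n hn
  exact hn.symm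

theorem minimalLaplacian_symmetric :
    (G.minimalLaplacian hG.assumptionA).IsFormalAdjoint (G.minimalLaplacian hG.assumptionA) :=
  fun _ ψ => hG.inner_eq_of_finite (fun _ => rfl) ψ

/-- The adjoint of the minimal Laplacian acts as the formal Laplacian. -/
theorem adjoint_apply (f : (G.minimalLaplacian hG.assumptionA).adjoint.domain) (x : ℕ) :
    (G.minimalLaplacian hG.assumptionA).adjoint f x = G.laplacian (f : G.Ell2) x := by
  set δ := unitMass hG.assumptionA x
  have h := adjoint_isFormalAdjoint (dense_minimalLaplacian_domain hG.assumptionA) f δ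
  rw [inner_unitMass] at h
  have ht := ((f : G.Ell2).summable_mul
    (G.minimalLaplacian hG.assumptionA δ)).hasSum.tendsto_sum_nat.comp (tendsto_add_atTop_nat 1)
  rw [← Ell2.inner_def, ← h] at ht
  refine mul_right_cancel₀ (G.m_pos x).ne' (tendsto_nhds_unique ht
    (tendsto_const_nhds.congr' ?_))
  filter_upwards [G.eventually_wronskian_eq_zero (f : G.Ell2) δ.2, eventually_ge_atTop x]
    with n hn hx
  -- Beyond the support of δ the boundary term vanishes, and the first sum reduces to its term at x.
  have hs := hG.sum_laplacian_mul_sub (f : G.Ell2) (δ : G.Ell2) n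
  rw [hn, Finset.sum_eq_single x
    (fun y _ hy => by rw [unitMass_apply_of_ne hG.assumptionA hy]; ring)
    (fun hx' => absurd (Finset.mem_range.2 (by omega)) hx'), unitMass_apply_self, mul_one,
    sub_eq_zero] at hs
  exact hs

theorem mem_adjoint_domain {f F : G.Ell2} (hF : ∀ x, F x = G.laplacian f x) :
    f ∈ (G.minimalLaplacian hG.assumptionA).adjoint.domain :=
  mem_adjoint_domain_of_exists f ⟨F, hG.inner_eq_of_finite hF⟩

/-- Summation by parts: the difference of the two sides is the energy of `f` on the edges below `n`.
-/
theorem flux_mul_le_sum (f : ℕ → ℝ) (n : ℕ) :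
    G.flux f n * f n ≤ ∑ x ∈ Finset.range (n + 1), G.laplacian f x * f x * G.m x := by
  induction n with
  | zero =>
    have hf := hG.laplacian_zero f
    simp only [zero_add, Finset.sum_range_one]
    rw [← hf]
    exact le_of_eq (by ring)
  | succ n ih =>
    have hf := hG.laplacian_succ f n
    have h : 0 ≤ G.flux f n * (f n - f (n + 1)) := by
      rw [flux, mul_assoc]
      exact mul_nonneg (hG.b_pos n).le (mul_self_nonneg _)
    rw [Finset.sum_range_succ, show G.laplacian f (n + 1) * f (n + 1) * G.m (n + 1) =
      (G.flux f (n + 1) - G.flux f n) * f (n + 1) by rw [← hf]; ring]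
    linarith

theorem minimalLaplacian_nonneg (φ : (G.minimalLaplacian hG.assumptionA).domain) :
    0 ≤ ⟪G.minimalLaplacian hG.assumptionA φ, (φ : G.Ell2)⟫_ℝ := by
  rw [Ell2.inner_def]
  refine ge_of_tendsto ((((G.minimalLaplacian hG.assumptionA φ).summable_mul
    φ).hasSum.tendsto_sum_nat).comp (tendsto_add_atTop_nat 1)) ?_
  filter_upwards [eventually_eq_zero_of_finite φ.2] with n hn
  have h := hG.flux_mul_le_sum (φ : G.Ell2) n
  rw [hn, mul_zero] at h
  exact h

/-! ### The resistance and the solutions of Δf = -f -/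

theorem flux_resistance (n : ℕ) : G.flux G.resistance n = -1 := by
  have := (hG.b_pos n).ne'
  rw [flux, resistance, resistance, Finset.sum_range_succ]
  field_simp
  ring

theorem laplacian_resistance_succ (n : ℕ) : G.laplacian G.resistance (n + 1) = 0 := by
  have h := hG.laplacian_succ G.resistance n
  rw [hG.flux_resistance, hG.flux_resistance, sub_self] at h
  exact (mul_eq_zero.1 h).resolve_right (G.m_pos _).ne'

theorem wronskian_one_resistance (n : ℕ) : G.wronskian 1 G.resistance n = 1 := by
  have h := hG.flux_resistance n
  simp only [flux, wronskian, Pi.one_apply] at *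
  linarith

theorem resistance_nonneg (n : ℕ) : 0 ≤ G.resistance n :=
  Finset.sum_nonneg fun k _ => (one_div_pos.2 (hG.b_pos k)).le

/-- A solution of `Δ f = -f` grows at least as fast as the resistance. -/
theorem resistance_le_of_laplacian_eq_neg {f : ℕ → ℝ} (hf : ∀ x, G.laplacian f x = -f x) (n : ℕ) :
    f 0 ^ 2 * (G.m 0 * G.resistance n) ≤ f 0 * f n ∧ f 0 * G.flux f n ≤ -(f 0 ^ 2 * G.m 0) := by
  -- The factor `f 0` covers both signs of f(0). The flux bound makes `f 0 * f` grow by at least the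
  -- next resistance; its nonnegativity then keeps the flux bound.
  induction n with
  | zero =>
    have h := hG.laplacian_zero f
    rw [hf] at h
    refine ⟨?_, le_of_eq ?_⟩
    · simp only [resistance, Finset.range_zero, Finset.sum_empty, mul_zero]
      exact mul_self_nonneg _
    · rw [← h]; ring
  | succ n ih =>
    obtain ⟨h1, h2⟩ := ih
    have hb := hG.b_pos n
    have hs := hG.laplacian_succ f n
    rw [hf] at hs
    have h3 : f 0 * f (n + 1) = f 0 * f n - f 0 * G.flux f n / G.b n (n + 1) := by
      rw [flux]
      field_simp
      ring
    have h4 : f 0 ^ 2 * (G.m 0 * G.resistance (n + 1)) ≤ f 0 * f (n + 1) := by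
      have h5 : f 0 * G.flux f n / G.b n (n + 1) ≤ -(f 0 ^ 2 * G.m 0) / G.b n (n + 1) :=
        div_le_div_of_nonneg_right h2 hb.le
      have h6 : f 0 ^ 2 * (G.m 0 * G.resistance (n + 1)) =
          f 0 ^ 2 * (G.m 0 * G.resistance n) - -(f 0 ^ 2 * G.m 0) / G.b n (n + 1) := by
        rw [resistance, Finset.sum_range_succ, ← resistance]
        ring
      linarith
    refine ⟨h4, ?_⟩
    have h7 : 0 ≤ f 0 * f (n + 1) :=
      le_trans (mul_nonneg (sq_nonneg _) (mul_nonneg (G.m_pos 0).le (hG.resistance_nonneg _))) h4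
    have h8 := mul_nonneg h7 (G.m_pos (n + 1)).le
    have h9 : f 0 * G.flux f (n + 1) = f 0 * G.flux f n - f 0 * f (n + 1) * G.m (n + 1) := by
      linear_combination -f 0 * hs
    linarith

/-- The value at 0 fixes the first flux and, recursively, the whole solution. -/
theorem eq_zero_of_laplacian_eq_neg {f : ℕ → ℝ} (hf : ∀ x, G.laplacian f x = -f x)
    (h0 : f 0 = 0) (n : ℕ) : f n = 0 ∧ G.flux f n = 0 := by
  induction n with
  | zero =>
    refine ⟨h0, ?_⟩
    rw [← hG.laplacian_zero f, hf, h0, neg_zero, zero_mul]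
  | succ n ih =>
    obtain ⟨h1, h2⟩ := ih
    have h3 : f (n + 1) = 0 := by
      have := (mul_eq_zero.1 h2).resolve_left (hG.b_pos n).ne'
      linarith
    refine ⟨h3, ?_⟩
    have hs := hG.laplacian_succ f n
    rw [hf, h3, h2] at hs
    linarith

theorem resistance_mem_of_laplacian_eq_neg {f : G.Ell2} (hf : ∀ x, G.laplacian f x = -f x)
    (hne : f ≠ 0) : G.resistance ∈ G.squareSummable := by
  have h0 : f 0 ≠ 0 := fun h0 =>
    hne (Ell2.ext fun n => (hG.eq_zero_of_laplacian_eq_neg hf h0 n).1)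
  have hm := G.m_pos 0
  have hc : 0 < f 0 ^ 2 * G.m 0 := by positivity
  refine Summable.of_nonneg_of_le (fun x => mul_nonneg (sq_nonneg _) (G.m_pos x).le)
    (fun x => ?_) (f.summable_sq.mul_left ((f 0 / (f 0 ^ 2 * G.m 0)) ^ 2))
  have h1 : G.resistance x ≤ f 0 / (f 0 ^ 2 * G.m 0) * f x := by
    rw [div_mul_eq_mul_div, le_div_iff₀ hc]
    linarith [(hG.resistance_le_of_laplacian_eq_neg hf x).1]
  rw [← mul_assoc, ← mul_pow]
  exact mul_le_mul_of_nonneg_right (pow_le_pow_left₀ (hG.resistance_nonneg x) h1 2) (G.m_pos x).le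

/-! ### The two implications -/

theorem isEssentiallySelfAdjoint_of_resistance_notMem (h : G.resistance ∉ G.squareSummable) :
    (G.minimalLaplacian hG.assumptionA).IsEssentiallySelfAdjoint := by
  have hd := dense_minimalLaplacian_domain hG.assumptionA
  have hsym := hG.minimalLaplacian_symmetric
  refine isEssentiallySelfAdjoint_of_adjoint_symmetric hd hsym
    (adjoint_symmetric_of_nonneg hd hG.minimalLaplacian_nonneg hsym fun f hf => ?_)
  by_contra hne
  refine h (hG.resistance_mem_of_laplacian_eq_neg (f := f) (fun x => ?_) hne)
  have hx : (-(f : G.Ell2) + f) x = 0 := by rw [neg_add_cancel, Ell2.zero_apply]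
  rw [← hG.adjoint_apply, hf]
  exact eq_neg_of_add_eq_zero_left hx

/-- Away from 0, where it vanishes, the resistance is at least 1 / b(0, 1). -/
theorem one_mem_squareSummable (h : G.resistance ∈ G.squareSummable) :
    (1 : ℕ → ℝ) ∈ G.squareSummable := by
  have hb := hG.b_pos 0
  have h' : Summable fun n => G.resistance n ^ 2 * G.m n := h
  refine (summable_nat_add_iff 1).1 (Summable.of_nonneg_of_le
    (fun x => mul_nonneg (sq_nonneg _) (G.m_pos _).le) (fun n => ?_)
    (((summable_nat_add_iff 1).2 h').mul_left (G.b 0 1 ^ 2)))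
  have h1 : 1 ≤ G.b 0 1 * G.resistance (n + 1) := by
    have : 1 / G.b 0 (0 + 1) ≤ G.resistance (n + 1) :=
      Finset.single_le_sum (f := fun k => 1 / G.b k (k + 1))
        (fun k _ => (one_div_pos.2 (hG.b_pos k)).le) (Finset.mem_range.2 (Nat.succ_pos n))
    rw [div_le_iff₀ hb] at this
    linarith
  rw [← mul_assoc, ← mul_pow]
  exact mul_le_mul_of_nonneg_right (pow_le_pow_left₀ (zero_le_one) h1 2) (G.m_pos _).le

theorem not_isEssentiallySelfAdjoint_of_resistance_mem (h : G.resistance ∈ G.squareSummable) :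
    ¬ (G.minimalLaplacian hG.assumptionA).IsEssentiallySelfAdjoint := by
  have hd := dense_minimalLaplacian_domain hG.assumptionA
  have hsym := hG.minimalLaplacian_symmetric
  set T := G.minimalLaplacian hG.assumptionA
  have hlap : G.laplacian G.resistance ∈ G.squareSummable :=
    mem_squareSummable_of_finite ((Set.finite_singleton 0).subset fun x hx => by
      rcases x with _ | x
      · rfl
      · exact absurd (hG.laplacian_resistance_succ x) hx)
  let p : T.adjoint.domain := ⟨Ell2.mk 1 (hG.one_mem_squareSummable h),
    hG.mem_adjoint_domain (F := 0) fun x => by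
      change (0 : ℝ) = 1 / G.m x * ∑' y, G.b x y * (1 - 1)
      simp⟩
  let q : T.adjoint.domain := ⟨Ell2.mk _ h,
    hG.mem_adjoint_domain (F := Ell2.mk _ hlap) fun x => rfl⟩
  -- The boundary form of the adjoint; it inherits the Plücker relation from the Wronskians as a
  -- limit.
  let B : T.adjoint.domain → T.adjoint.domain → ℝ := fun f g =>
    ⟪T.adjoint f, (g : G.Ell2)⟫_ℝ - ⟪(f : G.Ell2), T.adjoint g⟫_ℝ
  have hB : ∀ f g : T.adjoint.domain,
      Tendsto (G.wronskian (f : G.Ell2) (g : G.Ell2)) atTop (𝓝 (B f g)) :=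
    fun f g => hG.tendsto_wronskian (hG.adjoint_apply f) (hG.adjoint_apply g)
  have hpq : B p q = 1 := tendsto_nhds_unique (hB p q)
    (tendsto_const_nhds.congr fun n => (hG.wronskian_one_resistance n).symm)
  have plucker : ∀ f g, B f g = B f p * B g q - B f q * B g p := fun f g => by
    have h1 := tendsto_nhds_unique ((hB f g).mul (hB p q))
      ((((hB f p).mul (hB g q)).sub ((hB f q).mul (hB g p))).congr fun n =>
        (G.wronskian_plucker _ _ _ _ n).symm)
    rwa [hpq, mul_one] at h1
  have sa_p : IsSelfAdjoint (T.adjointBoundaryRestrict p) :=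
    isSelfAdjoint_adjointBoundaryRestrict hd hsym p fun f g hf hg => sub_eq_zero.1 <| by
      have hf' : B f p = 0 := sub_eq_zero.2 hf
      have hg' : B g p = 0 := sub_eq_zero.2 hg
      exact (plucker f g).trans (by rw [hf', hg']; ring)
  have sa_q : IsSelfAdjoint (T.adjointBoundaryRestrict q) :=
    isSelfAdjoint_adjointBoundaryRestrict hd hsym q fun f g hf hg => sub_eq_zero.1 <| by
      have hf' : B f q = 0 := sub_eq_zero.2 hf
      have hg' : B g q = 0 := sub_eq_zero.2 hg
      exact (plucker f g).trans (by rw [hf', hg']; ring)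
  intro hess
  have heq := hess.unique ⟨sa_p, le_adjointBoundaryRestrict hd hsym p⟩
    ⟨sa_q, le_adjointBoundaryRestrict hd hsym q⟩
  -- By antisymmetry `p` meets its own boundary condition; if the extensions agreed, it would also
  -- meet that of `q`, against B(p, q) = 1.
  have hp : (p : G.Ell2) ∈ (T.adjointBoundaryRestrict p).domain :=
    (mem_adjointBoundaryRestrict_domain p).2 (real_inner_comm _ _)
  rw [heq, mem_adjointBoundaryRestrict_domain] at hp
  have hpq' : B p q = 0 := sub_eq_zero.2 hp
  exact one_ne_zero (hpq.symm.trans hpq')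

end IsBirthDeathChain

end WeightedGraph

theorem theoremt (G : WeightedGraph ℕ) (hG : G.IsBirthDeathChain) :
    (WeightedGraph.minimalLaplacian hG.assumptionA).IsEssentiallySelfAdjoint ↔
      ∑' r : ℕ, ENNReal.ofReal
        ((∑ k ∈ Finset.range (r + 1), 1 / G.b k (k + 1)) ^ 2 * G.m (r + 1)) = ⊤ := by
  have h := G.resistance_mem_squareSummable_iff.not_left
  refine ⟨fun hess => ?_, fun hsum => ?_⟩
  · exact h.1 fun hr => hG.not_isEssentiallySelfAdjoint_of_resistance_mem hr hess
  · exact hG.isEssentiallySelfAdjoint_of_resistance_notMem (h.2 hsum)
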